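/- For a finite set $S\subset\mathbb{R}^2$ of points, let $a_S$ be the number of distinct orderings of $S$ obtained by ranking the points of $S$ by increasing Euclidean distance from a vantage point $V$, as $V$ ranges over all points of the plane that lie on no perpendicular bisector of two points of $S$ (equivalently, $a_S$ is the number of regions into which the perpendicular bisectors of pairs of points of $S$ divide the plane). Let $M(n)$ be the maximum of $a_S$ over all $S\subset\mathbb{R}^2$ with $|S|=n$. Let $n,k\ge 0$ be integers with $k\le \frac n2$, and assume that $n\ge 4$ or $k=0$. Then there is a set $S\subset\mathbb{R}^2$ of exactly $n$ points with $a_S=M(n)-k$. -/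

import Mathlib

/-- `distOrder S V` is the relation on the points of `S` induced by the vantage point `V`:
`P` precedes `Q` precisely when `P` is strictly closer to `V` than `Q`. -/
def distOrder {d : ℕ} (S : Finset (EuclideanSpace ℝ (Fin d))) (V : EuclideanSpace ℝ (Fin d)) :
    S → S → Prop :=
  fun P Q => dist V (P : EuclideanSpace ℝ (Fin d)) < dist V (Q : EuclideanSpace ℝ (Fin d))

/-- The orderings of `S` produced by all vantage points `V` that lie on no perpendicular bisector
of two points of `S`, that is, for which the distances to the points of `S` have no ties. -/
def inducedOrderings {d : ℕ} (S : Finset (EuclideanSpace ℝ (Fin d))) : Set (S → S → Prop) :=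
  {r | ∃ V : EuclideanSpace ℝ (Fin d),
    Set.InjOn (fun P : EuclideanSpace ℝ (Fin d) => dist V P) (S : Set (EuclideanSpace ℝ (Fin d))) ∧
      r = distOrder S V}

/-- `a_S`: the number of distinct orderings of `S` as the vantage point moves. -/
noncomputable def numOrderings {d : ℕ} (S : Finset (EuclideanSpace ℝ (Fin d))) : ℕ :=
  (inducedOrderings S).ncard

/-- `M(n, d)`: the maximum of `a_S` over all `S ⊂ ℝ^d` with exactly `n` points. -/
noncomputable def maxOrderings (n d : ℕ) : ℕ :=
  sSup {m : ℕ | ∃ S : Finset (EuclideanSpace ℝ (Fin d)), S.card = n ∧ numOrderings S = m}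

/-- The supremum in the definition of `maxOrderings` is an attained maximum (in dimension `≥ 1`). -/
theorem maxOrderings_isGreatest (n d : ℕ) (hd : 1 ≤ d) :
    IsGreatest {m : ℕ | ∃ S : Finset (EuclideanSpace ℝ (Fin d)), S.card = n ∧ numOrderings S = m}
      (maxOrderings n d) := by
  have hbdd : BddAbove
      {m : ℕ | ∃ S : Finset (EuclideanSpace ℝ (Fin d)), S.card = n ∧ numOrderings S = m} := by
    refine ⟨(2 ^ n) ^ n, ?_⟩
    rintro m ⟨S, hS, rfl⟩
    have h := Set.ncard_le_ncard (Set.subset_univ (inducedOrderings S)) Set.finite_univ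
    rw [Set.ncard_univ, Nat.card_fun, Nat.card_fun] at h
    simpa [numOrderings, hS] using h
  have hne : Set.Nonempty
      {m : ℕ | ∃ S : Finset (EuclideanSpace ℝ (Fin d)), S.card = n ∧ numOrderings S = m} := by
    have : Nonempty (Fin d) := ⟨⟨0, hd⟩⟩
    have : Nontrivial (EuclideanSpace ℝ (Fin d)) := inferInstance
    have : Infinite (EuclideanSpace ℝ (Fin d)) := Module.Free.infinite ℝ _
    obtain ⟨S, hS⟩ := Infinite.exists_subset_card_eq (EuclideanSpace ℝ (Fin d)) n
    exact ⟨_, S, hS, rfl⟩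
  exact ⟨Nat.sSup_mem hne hbdd, fun m hm => le_csSup hbdd hm⟩

/-! The orderings of `S` are the cells of its arrangement of perpendicular bisectors, and these are
counted by adding one point `R` to `S` at a time. The bisectors of `R, i` and `R, j` meet only on
the old bisector of `i, j`, so the bisector of `R, i` adds one cell more than it has points on old
bisectors, whatever other new bisectors are present (`numOrderings_insert`). With `m` old points
this is at most `1 + m.choose 2`, and summing gives the upper bound `genericOrderings`.

The bound is missed in a controlled way by making bisectors parallel. Let `R` be generic on the line
through `p` with direction `u`, avoiding finitely many bad positions. Then the bisector of `R, i`
misses that of `a, b` exactly when `i` is on this line and `a - b` is parallel to `u`; all other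
intersections exist and are distinct. So the deficiency grows by (points of `S` on the line) times
(pairs of `S` parallel to `u`), as stated in `numOrderings_insert_add`.

A direction parallel to no pair adds 0. The direction of a pair that is parallel to no other pair,
taken through a third point, adds 1, and a new pair with a direction of its own arises, so the step
can be repeated. From three generic points this gives every `k ≤ n - 3`. The one remaining case with
`2 * k ≤ n` and `4 ≤ n`, apart from these, is `n = 4`, `k = 2`: three collinear points, which lose
2, and a generic fourth. -/

/-! ### Counting the cells of a hyperplane arrangement -/

/-- The sign patterns over `A` of the real functions `f i` at the points of `X` where none of the
`f i` with `i ∈ A` vanishes; a pattern is recorded as the set of `i ∈ A` with `0 < f i x`. -/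
def signPatterns {ι E : Type*} (f : ι → E → ℝ) (A : Finset ι) (X : Set E) : Set (Finset ι) :=
  open Classical in
  {σ | ∃ x ∈ X, (∀ i ∈ A, f i x ≠ 0) ∧ A.filter (fun i => 0 < f i x) = σ}

theorem signPatterns_finite {ι E : Type*} (f : ι → E → ℝ) (A : Finset ι) (X : Set E) :
    (signPatterns f A X).Finite := by
  classical
  refine (A.powerset.finite_toSet).subset ?_
  rintro σ ⟨x, -, -, rfl⟩
  exact Finset.mem_coe.2 (Finset.mem_powerset.2 (Finset.filter_subset _ _))

theorem signPatterns_union {ι E : Type*} (f : ι → E → ℝ) (A : Finset ι) (X Y : Set E) :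
    signPatterns f A (X ∪ Y) = signPatterns f A X ∪ signPatterns f A Y := by
  ext σ
  constructor
  · rintro ⟨x, hx | hx, h⟩
    · exact Or.inl ⟨x, hx, h⟩
    · exact Or.inr ⟨x, hx, h⟩
  · rintro (⟨x, hx, h⟩ | ⟨x, hx, h⟩)
    · exact ⟨x, Or.inl hx, h⟩
    · exact ⟨x, Or.inr hx, h⟩

/-- Near `x`, moving along the line through `x` and `y` does not change a sign pattern. -/
theorem eventually_signs_lineMap {ι E : Type*} [AddCommGroup E] [Module ℝ E]
    (f : ι → E →ᵃ[ℝ] ℝ) (A : Finset ι) (x y : E) (hx : ∀ i ∈ A, f i x ≠ 0) :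
    ∀ᶠ s in nhds (0 : ℝ), ∀ i ∈ A, f i (AffineMap.lineMap x y s) ≠ 0 ∧
      (0 < f i (AffineMap.lineMap x y s) ↔ 0 < f i x) := by
  rw [Filter.eventually_all_finset]
  intro i hi
  have hc : Continuous (fun s : ℝ => f i (AffineMap.lineMap x y s)) := by
    simp only [AffineMap.apply_lineMap, AffineMap.lineMap_apply_ring']
    fun_prop
  have h0 : f i (AffineMap.lineMap x y (0 : ℝ)) = f i x := by simp
  rcases lt_or_gt_of_ne (hx i hi) with h | h
  · filter_upwards [hc.continuousAt.eventually_lt_const (h0.trans_lt h)] with s hs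
    exact ⟨hs.ne, ⟨fun h' => absurd h' hs.not_gt, fun h' => absurd h' h.not_gt⟩⟩
  · filter_upwards [hc.continuousAt.eventually_const_lt (h0.symm ▸ h)] with s hs
    exact ⟨hs.ne', ⟨fun _ => h, fun _ => hs⟩⟩

/-- A pattern that occurs on the zero set of `g` also occurs on both of its sides. -/
theorem exists_signs_both_sides {ι E : Type*} [AddCommGroup E] [Module ℝ E]
    (f : ι → E →ᵃ[ℝ] ℝ) (A : Finset ι) (g : E →ᵃ[ℝ] ℝ) (hg : g ≠ 0) (x : E)
    (hx : ∀ i ∈ A, f i x ≠ 0) (hgx : g x = 0) :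
    (∃ y, 0 < g y ∧ ∀ i ∈ A, f i y ≠ 0 ∧ (0 < f i y ↔ 0 < f i x)) ∧
      (∃ y, g y < 0 ∧ ∀ i ∈ A, f i y ≠ 0 ∧ (0 < f i y ↔ 0 < f i x)) := by
  obtain ⟨y, hy⟩ : ∃ y, g y ≠ 0 := by
    by_contra! h
    exact hg (AffineMap.ext fun z => h z)
  obtain ⟨ε, hε, hball⟩ := Metric.eventually_nhds_iff.1 (eventually_signs_lineMap f A x y hx)
  -- Along this line `g` is linear in `s`, so it takes opposite signs at `ε / 2` and `-(ε / 2)`.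
  have hval (s : ℝ) : g (AffineMap.lineMap x y s) = s * g y := by
    rw [AffineMap.apply_lineMap, AffineMap.lineMap_apply_ring', hgx]; ring
  have hp := @hball (ε / 2) (by rw [Real.dist_eq, sub_zero, abs_of_pos] <;> linarith)
  have hm := @hball (-(ε / 2)) (by rw [Real.dist_eq, sub_zero, abs_neg, abs_of_pos] <;> linarith)
  rcases lt_or_gt_of_ne hy with h | h
  · exact ⟨⟨_, by rw [hval]; nlinarith, hm⟩, ⟨_, by rw [hval]; nlinarith, hp⟩⟩
  · exact ⟨⟨_, by rw [hval]; nlinarith, hp⟩, ⟨_, by rw [hval]; nlinarith, hm⟩⟩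

/-- Deletion–restriction for the number of cells of a hyperplane arrangement. -/
theorem ncard_signPatterns_insert {ι E : Type*} [DecidableEq ι] [AddCommGroup E] [Module ℝ E]
    (f : ι → E →ᵃ[ℝ] ℝ) (A : Finset ι) (j : ι) (hj : j ∉ A) (hf : f j ≠ 0) :
    (signPatterns (fun i => f i) (insert j A) Set.univ).ncard =
      (signPatterns (fun i => f i) A Set.univ).ncard +
        (signPatterns (fun i => f i) A {x | f j x = 0}).ncard := by
  classical
  -- The cells of the larger arrangement number `|P| + |N| = |P ∪ N| + |P ∩ N|`. The union consists
  -- of the old cells, the intersection of the old cells cut by the new hyperplane.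
  set P := signPatterns (fun i => f i) A {x | 0 < f j x} with hP
  set N := signPatterns (fun i => f i) A {x | f j x < 0} with hN
  have hsub {X : Set E} {σ : Finset ι} (h : σ ∈ signPatterns (fun i => f i) A X) : j ∉ σ := by
    obtain ⟨x, -, -, rfl⟩ := h
    simp [hj]
  have h1 : signPatterns (fun i => f i) (insert j A) Set.univ = (insert j '' P) ∪ N := by
    ext σ
    constructor
    · rintro ⟨x, -, hx, rfl⟩
      have hA : ∀ i ∈ A, f i x ≠ 0 := fun i hi => hx i (Finset.mem_insert_of_mem hi)
      rcases lt_or_gt_of_ne (hx j (Finset.mem_insert_self _ _)) with h | h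
      · exact Or.inr ⟨x, h, hA, by rw [Finset.filter_insert, if_neg h.not_gt]⟩
      · exact Or.inl ⟨_, ⟨x, h, hA, rfl⟩, by rw [Finset.filter_insert, if_pos h]⟩
    · rintro (⟨_, ⟨x, hxp, hA, rfl⟩, rfl⟩ | ⟨x, hxp, hA, rfl⟩)
      · refine ⟨x, trivial, ?_, by rw [Finset.filter_insert, if_pos (show 0 < f j x from hxp)]⟩
        rintro i hi
        rcases Finset.mem_insert.1 hi with rfl | hi
        · exact ne_of_gt hxp
        · exact hA i hi
      · refine ⟨x, trivial, ?_, by rw [Finset.filter_insert, if_neg (not_lt_of_gt (show f j x < 0 from hxp))]⟩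
        rintro i hi
        rcases Finset.mem_insert.1 hi with rfl | hi
        · exact ne_of_lt hxp
        · exact hA i hi
  have h2 : Disjoint (insert j '' P) N := by
    rw [Set.disjoint_left]
    rintro _ ⟨σ, -, rfl⟩ h
    exact hsub h (Finset.mem_insert_self _ _)
  have h3 : (insert j '' P).ncard = P.ncard := by
    refine Set.InjOn.ncard_image fun σ hσ τ hτ h => ?_
    have := congrArg (fun s => s.erase j) h
    simpa [Finset.erase_insert (hsub hσ), Finset.erase_insert (hsub hτ)] using this
  have hside (x : E) (hx : ∀ i ∈ A, f i x ≠ 0) (h0 : f j x = 0) :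
      A.filter (fun i => 0 < f i x) ∈ P ∧ A.filter (fun i => 0 < f i x) ∈ N := by
    obtain ⟨⟨y, hy, hyA⟩, ⟨z, hz, hzA⟩⟩ := exists_signs_both_sides f A (f j) hf x hx h0
    exact ⟨⟨y, hy, fun i hi => (hyA i hi).1, Finset.filter_congr fun i hi => (hyA i hi).2⟩,
      ⟨z, hz, fun i hi => (hzA i hi).1, Finset.filter_congr fun i hi => (hzA i hi).2⟩⟩
  have h4 : signPatterns (fun i => f i) A Set.univ = P ∪ N := by
    rw [hP, hN, ← signPatterns_union]
    ext σ
    constructor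
    · rintro ⟨x, -, hx, rfl⟩
      rcases lt_trichotomy (f j x) 0 with h | h | h
      · exact ⟨x, Or.inr h, hx, rfl⟩
      · rw [signPatterns_union]
        exact Or.inl (hside x hx h).1
      · exact ⟨x, Or.inl h, hx, rfl⟩
    · rintro ⟨x, -, h⟩
      exact ⟨x, trivial, h⟩
  have h5 : signPatterns (fun i => f i) A {x | f j x = 0} = P ∩ N := by
    ext σ
    constructor
    · rintro ⟨x, h0, hx, rfl⟩
      exact hside x hx h0
    · rintro ⟨⟨x, hxp, hx, rfl⟩, ⟨y, hyn, hy, hxy⟩⟩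
      have hsame : ∀ i ∈ A, (0 < f i x ↔ 0 < f i y) := fun i hi => by
        have := Finset.ext_iff.1 hxy i
        simpa [hi, iff_comm] using this
      have hxp' : 0 < f j x := hxp
      have hyn' : f j y < 0 := hyn
      -- The parameter where the segment from `x` to `y` crosses the zero set of `f j`; the cell is
      -- convex, so the crossing point has the same signs.
      set t : ℝ := f j x / (f j x - f j y) with ht
      have hd : 0 < f j x - f j y := by linarith
      have ht0 : 0 < t := div_pos hxp' hd
      have ht1 : t < 1 := by rw [ht, div_lt_one hd]; linarith
      have hval (i : ι) : f i (AffineMap.lineMap x y t) = (1 - t) * f i x + t * f i y := by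
        rw [AffineMap.apply_lineMap, AffineMap.lineMap_apply_ring]
      have hsgn : ∀ i ∈ A, f i (AffineMap.lineMap x y t) ≠ 0 ∧
          (0 < f i (AffineMap.lineMap x y t) ↔ 0 < f i x) := by
        intro i hi
        rw [hval]
        rcases lt_or_gt_of_ne (hx i hi) with h | h
        · have h' : f i y < 0 :=
            lt_of_le_of_ne (not_lt.1 fun h' => h.not_gt ((hsame i hi).2 h')) (hy i hi)
          have : (1 - t) * f i x + t * f i y < 0 := by nlinarith
          exact ⟨this.ne, ⟨fun h' => absurd h' this.not_gt, fun h' => absurd h' h.not_gt⟩⟩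
        · have h' : 0 < f i y := (hsame i hi).1 h
          have : 0 < (1 - t) * f i x + t * f i y := by nlinarith
          exact ⟨this.ne', ⟨fun _ => h, fun _ => this⟩⟩
      refine ⟨AffineMap.lineMap x y t, ?_, fun i hi => (hsgn i hi).1,
        Finset.filter_congr fun i hi => (hsgn i hi).2⟩
      change f j (AffineMap.lineMap x y t) = 0
      rw [hval, ht]
      field_simp
      ring
  rw [h1, Set.ncard_union_eq h2 ((signPatterns_finite _ _ _).image _) (signPatterns_finite _ _ _),
    h3, h4, h5, Set.ncard_union_add_ncard_inter _ _ (signPatterns_finite _ _ _)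
      (signPatterns_finite _ _ _)]

theorem affineMap_real_eq_zero_of_two_zeros (h : ℝ →ᵃ[ℝ] ℝ) {s t : ℝ} (hst : s ≠ t)
    (hs : h s = 0) (ht : h t = 0) : h = 0 := by
  ext r
  have hr : r = AffineMap.lineMap s t ((r - s) / (t - s)) := by
    rw [AffineMap.lineMap_apply_ring', div_mul_cancel₀ _ (sub_ne_zero.2 hst.symm)]; ring
  rw [hr, AffineMap.apply_lineMap, hs, ht]
  simp

theorem finite_zeros_real {ι : Type*} (h : ι → ℝ →ᵃ[ℝ] ℝ) (A : Finset ι)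
    (hne : ∀ i ∈ A, h i ≠ 0) : {t | ∃ i ∈ A, h i t = 0}.Finite := by
  have : {t | ∃ i ∈ A, h i t = 0} = ⋃ i ∈ A, {t | h i t = 0} := by ext; simp
  rw [this]
  refine A.finite_toSet.biUnion fun i hi => Set.Subsingleton.finite fun s hs t ht => ?_
  by_contra hst
  exact hne i hi (affineMap_real_eq_zero_of_two_zeros _ hst hs ht)

/-- Finitely many affine functions on the line cut it into one more piece than they have zeros. -/
theorem ncard_signPatterns_real {ι : Type*} (h : ι → ℝ →ᵃ[ℝ] ℝ) (A : Finset ι)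
    (hne : ∀ i ∈ A, h i ≠ 0) :
    (signPatterns (fun i => h i) A Set.univ).ncard = 1 + {t | ∃ i ∈ A, h i t = 0}.ncard := by
  classical
  induction A using Finset.induction_on with
  | empty =>
    have : signPatterns (fun i => h i) ∅ Set.univ = {∅} := by
      ext σ
      simp [signPatterns, eq_comm]
    simp [this]
  | insert j A hj ih =>
    have hneA : ∀ i ∈ A, h i ≠ 0 := fun i hi => hne i (Finset.mem_insert_of_mem hi)
    rw [ncard_signPatterns_insert h A j hj (hne j (Finset.mem_insert_self _ _)), ih hneA]
    -- Either `h j` has a zero that is not an old one, which splits one piece, or the restricted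
    -- arrangement has no cell.
    by_cases hz : ∃ z, h j z = 0 ∧ ∀ i ∈ A, h i z ≠ 0
    · obtain ⟨z, hjz, hz⟩ := hz
      have huniq (t : ℝ) (ht : h j t = 0) : t = z := by
        by_contra htz
        exact hne j (Finset.mem_insert_self _ _)
          (affineMap_real_eq_zero_of_two_zeros _ htz ht hjz)
      have h1 : signPatterns (fun i => h i) A {x | h j x = 0} =
          {A.filter (fun i => 0 < h i z)} := by
        ext σ
        constructor
        · rintro ⟨x, hx, -, rfl⟩
          rw [huniq x hx]; simp
        · rintro rfl
          exact ⟨z, hjz, hz, by congr⟩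
      have h2 : {t | ∃ i ∈ insert j A, h i t = 0} = insert z {t | ∃ i ∈ A, h i t = 0} := by
        ext t
        simp only [Finset.exists_mem_insert, Set.mem_ofPred_eq, Set.mem_insert_iff]
        exact or_congr ⟨huniq t, fun ht => ht ▸ hjz⟩ Iff.rfl
      have h3 : z ∉ {t | ∃ i ∈ A, h i t = 0} := by
        rintro ⟨i, hi, h0⟩
        exact hz i hi h0
      rw [h1, h2, Set.ncard_insert_of_notMem h3 (finite_zeros_real h A hneA),
        Set.ncard_singleton]
      ring
    · push Not at hz
      have h1 : signPatterns (fun i => h i) A {x | h j x = 0} = ∅ := by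
        ext σ
        simp only [Set.mem_empty_iff_false, iff_false]
        rintro ⟨x, hx, hx', -⟩
        obtain ⟨i, hi, h0⟩ := hz x hx
        exact hx' i hi h0
      have h2 : {t | ∃ i ∈ insert j A, h i t = 0} = {t | ∃ i ∈ A, h i t = 0} := by
        ext t
        simp only [Finset.exists_mem_insert, Set.mem_ofPred_eq]
        exact ⟨fun ht => ht.elim (hz t) id, Or.inr⟩
      rw [h1, h2]
      simp

/-- Adding a hyperplane that is contained in an old one does not create cells. -/
theorem ncard_signPatterns_insert_of_vanish {ι E : Type*} [DecidableEq ι] [AddCommGroup E]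
    [Module ℝ E] (f : ι → E →ᵃ[ℝ] ℝ) (A : Finset ι) (j : ι) (hj : j ∉ A) (hf : f j ≠ 0)
    (hv : ∃ i ∈ A, ∀ x, f j x = 0 → f i x = 0) :
    (signPatterns (fun i => f i) (insert j A) Set.univ).ncard =
      (signPatterns (fun i => f i) A Set.univ).ncard := by
  rw [ncard_signPatterns_insert f A j hj hf]
  have : signPatterns (fun i => f i) A {x | f j x = 0} = ∅ := by
    obtain ⟨i, hi, hv⟩ := hv
    ext σ
    simp only [Set.mem_empty_iff_false, iff_false]
    rintro ⟨x, hx, hx', -⟩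
    exact hx' i hi (hv x hx)
  simp [this]

/-- Adding a new line `range g` to an arrangement creates one more cell than there are points of
the old lines on it. -/
theorem ncard_signPatterns_insert_of_line {ι E : Type*} [DecidableEq ι] [AddCommGroup E]
    [Module ℝ E] (f : ι → E →ᵃ[ℝ] ℝ) (A : Finset ι) (j : ι) (hj : j ∉ A) (hf : f j ≠ 0)
    (g : ℝ →ᵃ[ℝ] E) (hg : Function.Injective g) (hrange : ∀ x, f j x = 0 ↔ x ∈ Set.range g)
    (hv : ∀ i ∈ A, ∃ x, f j x = 0 ∧ f i x ≠ 0) :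
    (signPatterns (fun i => f i) (insert j A) Set.univ).ncard =
      (signPatterns (fun i => f i) A Set.univ).ncard +
        (1 + {x | f j x = 0 ∧ ∃ i ∈ A, f i x = 0}.ncard) := by
  classical
  have hne : ∀ i ∈ A, (f i).comp g ≠ 0 := by
    intro i hi h0
    obtain ⟨x, hx, hix⟩ := hv i hi
    obtain ⟨t, rfl⟩ := (hrange x).1 hx
    exact hix (by simpa using congrArg (fun k : ℝ →ᵃ[ℝ] ℝ => k t) h0)
  have h1 : signPatterns (fun i => f i) A {x | f j x = 0} =
      signPatterns (fun i => (f i).comp g) A Set.univ := by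
    ext σ
    constructor
    · rintro ⟨x, hx, h⟩
      obtain ⟨t, rfl⟩ := (hrange x).1 hx
      exact ⟨t, trivial, h⟩
    · rintro ⟨t, -, h⟩
      exact ⟨g t, (hrange _).2 ⟨t, rfl⟩, h⟩
  have h2 : {x | f j x = 0 ∧ ∃ i ∈ A, f i x = 0} =
      g '' {t | ∃ i ∈ A, (f i).comp g t = 0} := by
    ext x
    constructor
    · rintro ⟨hx, h⟩
      obtain ⟨t, rfl⟩ := (hrange x).1 hx
      exact ⟨t, h, rfl⟩
    · rintro ⟨t, h, rfl⟩
      exact ⟨(hrange _).2 ⟨t, rfl⟩, h⟩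
  rw [ncard_signPatterns_insert f A j hj hf, h1, h2, ncard_signPatterns_real _ A hne,
    Set.ncard_image_of_injective _ hg]

/-! ### Perpendicular bisectors and orderings -/

/-- The Euclidean plane. -/
abbrev Plane := EuclideanSpace ℝ (Fin 2)

theorem Plane.ext {x y : Plane} (h0 : x 0 = y 0) (h1 : x 1 = y 1) : x = y := by
  ext i; fin_cases i
  · exact h0
  · exact h1

theorem Plane.sq_sub_pos {x y : Plane} (h : x ≠ y) : 0 < (x 0 - y 0) ^ 2 + (x 1 - y 1) ^ 2 := by
  by_contra! hle
  exact h (Plane.ext (by nlinarith [sq_nonneg (x 0 - y 0), sq_nonneg (x 1 - y 1)])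
    (by nlinarith [sq_nonneg (x 0 - y 0), sq_nonneg (x 1 - y 1)]))

/-- The affine form that is positive at the points closer to `a` than to `b`; it is half the
difference of the squared distances and vanishes on the perpendicular bisector. -/
noncomputable def bisectorForm (a b : Plane) : Plane →ᵃ[ℝ] ℝ :=
  ((a 0 - b 0) • (EuclideanSpace.proj 0 : Plane →L[ℝ] ℝ).toLinearMap +
    (a 1 - b 1) • (EuclideanSpace.proj 1 : Plane →L[ℝ] ℝ).toLinearMap).toAffineMap +
    AffineMap.const ℝ Plane ((b 0 ^ 2 + b 1 ^ 2 - a 0 ^ 2 - a 1 ^ 2) / 2)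

theorem bisectorForm_apply (a b x : Plane) : bisectorForm a b x =
    (a 0 - b 0) * x 0 + (a 1 - b 1) * x 1 + (b 0 ^ 2 + b 1 ^ 2 - a 0 ^ 2 - a 1 ^ 2) / 2 := by
  simp [bisectorForm]

theorem bisectorForm_swap (a b x : Plane) : bisectorForm a b x = -bisectorForm b a x := by
  simp only [bisectorForm_apply]; ring

/-- Differences of squared distances telescope. Hence on the bisector of `R, i` the forms of `R, j`
and `i, j` agree, which reduces every new intersection to an old bisector. -/
theorem bisectorForm_cocycle (a b c x : Plane) :
    bisectorForm a c x = bisectorForm a b x + bisectorForm b c x := by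
  simp only [bisectorForm_apply]; ring

theorem dist_lt_dist_iff_bisectorForm (a b x : Plane) :
    dist x a < dist x b ↔ 0 < bisectorForm a b x := by
  rw [EuclideanSpace.dist_eq, EuclideanSpace.dist_eq, Real.sqrt_lt_sqrt_iff (by positivity),
    bisectorForm_apply]
  simp only [Fin.sum_univ_two, Real.dist_eq, sq_abs]
  constructor <;> intro h <;> nlinarith

theorem dist_eq_dist_iff_bisectorForm (a b x : Plane) :
    dist x a = dist x b ↔ bisectorForm a b x = 0 := by
  have h1 := dist_lt_dist_iff_bisectorForm a b x
  have h2 := dist_lt_dist_iff_bisectorForm b a x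
  rw [bisectorForm_swap] at h2
  constructor
  · intro h
    exact le_antisymm (not_lt.1 fun h' => h.not_lt (h1.2 h'))
      (not_lt.1 fun h' => h.not_gt (h2.2 (by linarith)))
  · intro h
    exact le_antisymm (not_lt.1 fun h' => absurd (h2.1 h') (by simp [h]))
      (not_lt.1 fun h' => absurd (h1.1 h') (by simp [h]))

theorem bisectorForm_ne_zero {a b : Plane} (h : a ≠ b) : bisectorForm a b ≠ 0 := by
  intro h0
  have hd := Plane.sq_sub_pos h
  have h1 : bisectorForm a b a = 0 := by rw [h0]; rfl
  rw [bisectorForm_apply] at h1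
  nlinarith

/-- Orderings and sign patterns are both functions of the vantage point; equal fibres give equally
many values. -/
theorem ncard_image_eq_ncard_image {α β γ : Type*} (s : Set α) (f : α → β) (g : α → γ)
    (h : ∀ x ∈ s, ∀ y ∈ s, f x = f y ↔ g x = g y) : (f '' s).ncard = (g '' s).ncard := by
  classical
  refine Set.ncard_congr (fun b hb => g hb.choose) (fun b hb => ⟨_, hb.choose_spec.1, rfl⟩) ?_ ?_
  · intro b c hb hc hbc
    rw [← hb.choose_spec.2, ← hc.choose_spec.2]
    exact (h _ hb.choose_spec.1 _ hc.choose_spec.1).2 hbc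
  · rintro _ ⟨x, hx, rfl⟩
    have hb : f x ∈ f '' s := ⟨x, hx, rfl⟩
    exact ⟨f x, hb, (h _ hb.choose_spec.1 _ hx).1 hb.choose_spec.2⟩

/-- Orderings correspond to the cells of the arrangement of perpendicular bisectors. -/
theorem numOrderings_eq_ncard_signPatterns (S : Finset Plane) (A : Finset (Plane × Plane))
    (hA : ∀ p ∈ A, p.1 ∈ S ∧ p.2 ∈ S ∧ p.1 ≠ p.2)
    (hcov : ∀ a ∈ S, ∀ b ∈ S, a ≠ b → (a, b) ∈ A ∨ (b, a) ∈ A) :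
    numOrderings S = (signPatterns (fun p => bisectorForm p.1 p.2) A Set.univ).ncard := by
  classical
  obtain ⟨G, hG⟩ : ∃ G : Set Plane, ∀ V, V ∈ G ↔ ∀ p ∈ A, bisectorForm p.1 p.2 V ≠ 0 :=
    ⟨{V | ∀ p ∈ A, bisectorForm p.1 p.2 V ≠ 0}, fun _ => Iff.rfl⟩
  have hGall : ∀ V ∈ G, ∀ a ∈ S, ∀ b ∈ S, a ≠ b → bisectorForm a b V ≠ 0 := by
    intro V hV a ha b hb hab
    rcases hcov a ha b hb hab with h | h
    · exact (hG V).1 hV (a, b) h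
    · rw [bisectorForm_swap, neg_ne_zero]
      exact (hG V).1 hV (b, a) h
  have h1 : inducedOrderings S = distOrder S '' G := by
    ext r
    constructor
    · rintro ⟨V, hV, rfl⟩
      refine ⟨V, (hG V).2 fun p hp h0 => ?_, rfl⟩
      obtain ⟨h1, h2, h3⟩ := hA p hp
      exact h3 (hV h1 h2 ((dist_eq_dist_iff_bisectorForm _ _ _).2 h0))
    · rintro ⟨V, hV, rfl⟩
      refine ⟨V, fun a ha b hb hab => ?_, rfl⟩
      by_contra hne
      exact hGall V hV a ha b hb hne ((dist_eq_dist_iff_bisectorForm _ _ _).1 hab)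
  have h2 : signPatterns (fun p => bisectorForm p.1 p.2) A Set.univ =
      (fun V => A.filter (fun p => 0 < bisectorForm p.1 p.2 V)) '' G := by
    ext σ
    constructor
    · rintro ⟨V, -, hV, rfl⟩
      exact ⟨V, (hG V).2 hV, by congr⟩
    · rintro ⟨V, hV, rfl⟩
      exact ⟨V, trivial, (hG V).1 hV, by congr⟩
  rw [numOrderings, h1, h2]
  refine ncard_image_eq_ncard_image _ _ _ fun V hV W hW => ⟨fun h => ?_, fun h => ?_⟩
  · refine Finset.filter_congr fun p hp => ?_
    obtain ⟨h1, h2, -⟩ := hA p hp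
    have := congrFun (congrFun h ⟨p.1, h1⟩) ⟨p.2, h2⟩
    simp only [distOrder, dist_lt_dist_iff_bisectorForm] at this
    exact Iff.of_eq this
  · have hmem (p : Plane × Plane) (hp : p ∈ A) :
        0 < bisectorForm p.1 p.2 V ↔ 0 < bisectorForm p.1 p.2 W := by
      have := Finset.ext_iff.1 h p
      simpa [hp] using this
    funext a b
    simp only [distOrder, dist_lt_dist_iff_bisectorForm, eq_iff_iff]
    by_cases hab : (a : Plane) = b
    · simp [hab, bisectorForm_apply]
    · rcases hcov a a.2 b b.2 hab with h | h
      · exact hmem (a, b) h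
      · have h3 := hmem _ h
        have h4 := (hG V).1 hV _ h
        have h5 := (hG W).1 hW _ h
        rw [bisectorForm_swap, neg_pos, bisectorForm_swap _ _ W, neg_pos]
        simp only at h3 h4 h5
        constructor
        · intro h'
          exact lt_of_le_of_ne (not_lt.1 fun h'' => h'.not_gt (h3.2 h'')) h5
        · intro h'
          exact lt_of_le_of_ne (not_lt.1 fun h'' => h'.not_gt (h3.1 h'')) h4

/-- The points equidistant from all points of `s`. -/
def equidistant (s : Finset Plane) : Set Plane :=
  {x | ∀ a ∈ s, ∀ b ∈ s, bisectorForm a b x = 0}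

theorem mem_equidistant_pair [DecidableEq Plane] {a b x : Plane} :
    x ∈ equidistant {a, b} ↔ bisectorForm a b x = 0 := by
  have haa (c : Plane) : bisectorForm c c x = 0 := by rw [bisectorForm_apply]; ring
  constructor
  · intro h
    exact h a (by simp) b (by simp)
  · intro h c hc d hd
    simp only [Finset.mem_insert, Finset.mem_singleton] at hc hd
    rcases hc with rfl | rfl <;> rcases hd with rfl | rfl
    · exact haa _
    · exact h
    · rw [bisectorForm_swap, h, neg_zero]
    · exact haa _

/-- An affine parametrization of the perpendicular bisector of `a` and `b`. -/
theorem exists_line_parametrization {a b : Plane} (hab : a ≠ b) :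
    ∃ g : ℝ →ᵃ[ℝ] Plane, Function.Injective g ∧
      ∀ x, bisectorForm a b x = 0 ↔ x ∈ Set.range g := by
  have hd := Plane.sq_sub_pos hab
  have hd' := hd.ne'
  -- The midpoint of `a, b`, and its translate by `a - b` turned through a right angle.
  set p : Plane := !₂[(a 0 + b 0) / 2, (a 1 + b 1) / 2] with hp
  set q : Plane := !₂[(a 0 + b 0) / 2 - (a 1 - b 1), (a 1 + b 1) / 2 + (a 0 - b 0)] with hq
  have hg0 (t : ℝ) : (AffineMap.lineMap p q t : Plane) 0 =
      (a 0 + b 0) / 2 - t * (a 1 - b 1) := by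
    simp [AffineMap.lineMap_apply, hp, hq]; ring
  have hg1 (t : ℝ) : (AffineMap.lineMap p q t : Plane) 1 =
      (a 1 + b 1) / 2 + t * (a 0 - b 0) := by
    simp [AffineMap.lineMap_apply, hp, hq]; ring
  refine ⟨AffineMap.lineMap p q, ?_, fun x => ⟨fun h => ?_, ?_⟩⟩
  · apply AffineMap.lineMap_injective
    intro hpq
    have h0 := congrArg (fun z : Plane => z 0) hpq
    have h1 := congrArg (fun z : Plane => z 1) hpq
    simp [hp, hq] at h0 h1
    nlinarith
  · rw [bisectorForm_apply] at h
    -- The component of `x - p` along `q - p`, as an inner product over the squared length.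
    refine ⟨((x 1 - (a 1 + b 1) / 2) * (a 0 - b 0) - (x 0 - (a 0 + b 0) / 2) * (a 1 - b 1)) /
      ((a 0 - b 0) ^ 2 + (a 1 - b 1) ^ 2), Plane.ext ?_ ?_⟩
    · rw [hg0]
      field_simp
      linear_combination (-2 * (a 0 - b 0)) * h
    · rw [hg1]
      field_simp
      linear_combination (-2 * (a 1 - b 1)) * h
  · rintro ⟨t, rfl⟩
    rw [bisectorForm_apply, hg0, hg1]
    ring

/-! ### Adding one point, and the upper bound -/

open Classical in
/-- The number of cells that the bisector of `R` and `i` adds to the bisector arrangement of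
`S`. -/
noncomputable def newCells (S : Finset Plane) (R i : Plane) : ℕ :=
  if ∃ a ∈ S, ∃ b ∈ S, a ≠ b ∧ ∀ x, bisectorForm R i x = 0 → bisectorForm a b x = 0 then 0
  else 1 + {x | bisectorForm R i x = 0 ∧ ∃ s ∈ S.powersetCard 2, x ∈ equidistant s}.ncard

theorem exists_powersetCard_two_iff (S : Finset Plane) (P : Finset Plane → Prop) :
    (∃ s ∈ S.powersetCard 2, P s) ↔ open Classical in
      ∃ a ∈ S, ∃ b ∈ S, a ≠ b ∧ P {a, b} := by
  classical
  constructor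
  · rintro ⟨s, hs, h⟩
    obtain ⟨hsS, hs2⟩ := Finset.mem_powersetCard.1 hs
    obtain ⟨a, b, hab, rfl⟩ := Finset.card_eq_two.1 hs2
    exact ⟨a, hsS (by simp), b, hsS (by simp), hab, by convert h⟩
  · rintro ⟨a, ha, b, hb, hab, h⟩
    refine ⟨{a, b}, Finset.mem_powersetCard.2 ⟨?_, Finset.card_pair hab⟩, by convert h⟩
    intro x hx
    simp only [Finset.mem_insert, Finset.mem_singleton] at hx
    rcases hx with rfl | rfl <;> assumption

open Classical in
/-- The new bisectors contribute independently, since two of them meet on an old bisector. -/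
theorem numOrderings_insert (S : Finset Plane) (R : Plane) (hR : R ∉ S) :
    numOrderings (insert R S) = numOrderings S + ∑ i ∈ S, newCells S R i := by
  -- The new bisectors are added one by one. Listing each old pair in both orientations is harmless,
  -- since a repeated line creates no cell.
  have key : ∀ S' ⊆ S,
      (signPatterns (fun p : Plane × Plane => bisectorForm p.1 p.2)
        (S.offDiag ∪ S'.image (fun i => (R, i))) Set.univ).ncard =
      numOrderings S + ∑ i ∈ S', newCells S R i := by
    intro S'
    induction S' using Finset.induction_on with
    | empty =>
      intro _
      rw [Finset.image_empty, Finset.union_empty, Finset.sum_empty, add_zero,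
        numOrderings_eq_ncard_signPatterns S S.offDiag]
      · intro p hp
        simpa using hp
      · intro a ha b hb hab
        exact Or.inl (Finset.mem_offDiag.2 ⟨ha, hb, hab⟩)
    | insert i S' hi ih =>
      intro hsub
      have hiS : i ∈ S := hsub (Finset.mem_insert_self _ _)
      have hsub' : S' ⊆ S := fun x hx => hsub (Finset.mem_insert_of_mem hx)
      have hRi : R ≠ i := fun h => hR (h ▸ hiS)
      set A := S.offDiag ∪ S'.image (fun i => (R, i)) with hA
      have hins : S.offDiag ∪ (insert i S').image (fun i => (R, i)) = insert (R, i) A := by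
        rw [Finset.image_insert, Finset.union_insert]
      have hnot : (R, i) ∉ A := by
        simp [hA, hR, hi]
      -- a zero of a form of `A` on the new line is a zero of an old form
      have hold : ∀ p ∈ A, ∃ a ∈ S, ∃ b ∈ S, a ≠ b ∧ ∀ x, bisectorForm R i x = 0 →
          (bisectorForm p.1 p.2 x = 0 ↔ bisectorForm a b x = 0) := by
        intro p hp
        rcases Finset.mem_union.1 hp with h | h
        · obtain ⟨h1, h2, h3⟩ := Finset.mem_offDiag.1 h
          exact ⟨_, h1, _, h2, h3, fun x _ => Iff.rfl⟩
        · obtain ⟨j, hj, rfl⟩ := Finset.mem_image.1 h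
          refine ⟨i, hiS, j, hsub' hj, fun hij => hi (hij ▸ hj), fun x hx => ?_⟩
          simp only
          rw [bisectorForm_cocycle R i j, hx, zero_add]
      rw [hins, Finset.sum_insert hi, add_comm (newCells S R i), ← add_assoc, ← ih hsub']
      by_cases hc : ∃ a ∈ S, ∃ b ∈ S, a ≠ b ∧
          ∀ x, bisectorForm R i x = 0 → bisectorForm a b x = 0
      · rw [newCells, if_pos hc, add_zero]
        refine ncard_signPatterns_insert_of_vanish
          (fun p : Plane × Plane => bisectorForm p.1 p.2) A (R, i) hnot
          (bisectorForm_ne_zero hRi) ?_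
        obtain ⟨a, ha, b, hb, hab, h⟩ := hc
        exact ⟨(a, b), Finset.mem_union_left _ (Finset.mem_offDiag.2 ⟨ha, hb, hab⟩), h⟩
      · obtain ⟨g, hg, hgr⟩ := exists_line_parametrization hRi
        rw [newCells, if_neg hc, ncard_signPatterns_insert_of_line
          (fun p : Plane × Plane => bisectorForm p.1 p.2) A (R, i) hnot
          (bisectorForm_ne_zero hRi) g hg hgr ?_]
        · congr 3
          ext x
          simp only [Set.mem_ofPred_eq, exists_powersetCard_two_iff, mem_equidistant_pair]
          refine and_congr_right fun hx => ⟨?_, ?_⟩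
          · rintro ⟨p, hp, h0⟩
            obtain ⟨a, ha, b, hb, hab, h⟩ := hold p hp
            exact ⟨a, ha, b, hb, hab, (h x hx).1 h0⟩
          · rintro ⟨a, ha, b, hb, hab, h⟩
            exact ⟨(a, b), Finset.mem_union_left _ (Finset.mem_offDiag.2 ⟨ha, hb, hab⟩), h⟩
        · intro p hp
          by_contra! hcon
          obtain ⟨a, ha, b, hb, hab, h⟩ := hold p hp
          exact hc ⟨a, ha, b, hb, hab, fun x hx => (h x hx).1 (hcon x hx)⟩
  rw [← key S subset_rfl]
  refine numOrderings_eq_ncard_signPatterns _ _ ?_ ?_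
  · intro p hp
    rcases Finset.mem_union.1 hp with h | h
    · obtain ⟨h1, h2, h3⟩ := Finset.mem_offDiag.1 h
      exact ⟨Finset.mem_insert_of_mem h1, Finset.mem_insert_of_mem h2, h3⟩
    · obtain ⟨j, hj, rfl⟩ := Finset.mem_image.1 h
      exact ⟨Finset.mem_insert_self _ _, Finset.mem_insert_of_mem hj, fun h : R = j => hR (h ▸ hj)⟩
  · intro a ha b hb hab
    simp only [Finset.mem_union, Finset.mem_offDiag, Finset.mem_image, Prod.mk.injEq]
    rcases Finset.mem_insert.1 ha with haR | haS
    · rcases Finset.mem_insert.1 hb with hbR | hbS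
      · exact absurd (haR.trans hbR.symm) hab
      · exact Or.inl (Or.inr ⟨b, hbS, haR.symm, rfl⟩)
    · rcases Finset.mem_insert.1 hb with hbR | hbS
      · exact Or.inr (Or.inr ⟨a, haS, hbR.symm, rfl⟩)
      · exact Or.inl (Or.inl ⟨haS, hbS, hab⟩)

/-- Two bisector lines with two common points coincide. -/
theorem bisectorForm_eq_zero_of_two_zeros {a b c d x y : Plane} (hab : a ≠ b) (hxy : x ≠ y)
    (hx : bisectorForm a b x = 0) (hy : bisectorForm a b y = 0)
    (hx' : bisectorForm c d x = 0) (hy' : bisectorForm c d y = 0) (z : Plane)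
    (hz : bisectorForm a b z = 0) : bisectorForm c d z = 0 := by
  obtain ⟨g, -, hgr⟩ := exists_line_parametrization hab
  obtain ⟨s, rfl⟩ := (hgr x).1 hx
  obtain ⟨t, rfl⟩ := (hgr y).1 hy
  obtain ⟨r, rfl⟩ := (hgr z).1 hz
  have := affineMap_real_eq_zero_of_two_zeros ((bisectorForm c d).comp g)
    (fun h => hxy (congrArg g h)) hx' hy'
  exact congrArg (fun k : ℝ →ᵃ[ℝ] ℝ => k r) this

/-- A new line contained in no old bisector meets each of the at most `S.card.choose 2` old ones in
at most one point. -/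
theorem newCells_le (S : Finset Plane) (R i : Plane) (hRi : R ≠ i) :
    newCells S R i ≤ 1 + S.card.choose 2 := by
  classical
  unfold newCells
  split_ifs with hc
  · exact Nat.zero_le _
  · refine Nat.add_le_add_left ?_ 1
    have h1 : {x | bisectorForm R i x = 0 ∧ ∃ s ∈ S.powersetCard 2, x ∈ equidistant s} =
        ⋃ s ∈ S.powersetCard 2, {x | bisectorForm R i x = 0 ∧ x ∈ equidistant s} := by
      ext x
      simp only [Set.mem_ofPred_eq, Set.mem_iUnion, exists_prop]
      tauto
    rw [h1, ← Finset.card_powersetCard]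
    refine (Finset.set_ncard_biUnion_le _ _).trans ?_
    refine (Finset.sum_le_card_nsmul _ _ 1 fun s hs => ?_).trans (by simp)
    obtain ⟨hsS, hs2⟩ := Finset.mem_powersetCard.1 hs
    obtain ⟨a, b, hab, rfl⟩ := Finset.card_eq_two.1 hs2
    have hsub : {x | bisectorForm R i x = 0 ∧ x ∈ equidistant {a, b}}.Subsingleton := by
      intro x hx y hy
      by_contra hxy
      simp only [mem_equidistant_pair, Set.mem_ofPred_eq] at hx hy
      exact hc ⟨a, hsS (by simp), b, hsS (by simp), hab,
        bisectorForm_eq_zero_of_two_zeros hRi hxy hx.1 hy.1 hx.2 hy.2⟩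
    exact (Set.ncard_le_one hsub.finite).2 fun x hx y hy => hsub hx hy

/-- The number of orderings of `n` points in general position. -/
def genericOrderings (n : ℕ) : ℕ := 1 + ∑ m ∈ Finset.range n, m * (1 + m.choose 2)

theorem genericOrderings_succ (n : ℕ) :
    genericOrderings (n + 1) = genericOrderings n + n * (1 + n.choose 2) := by
  rw [genericOrderings, genericOrderings, Finset.sum_range_succ, add_assoc]

theorem numOrderings_empty : numOrderings (∅ : Finset Plane) = 1 := by
  rw [numOrderings_eq_ncard_signPatterns ∅ ∅ (by simp) (by simp), Set.ncard_eq_one]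
  refine ⟨∅, ?_⟩
  ext σ
  simp [signPatterns, eq_comm]

theorem numOrderings_le (S : Finset Plane) : numOrderings S ≤ genericOrderings S.card := by
  classical
  induction S using Finset.induction_on with
  | empty => rw [numOrderings_empty]; simp [genericOrderings]
  | insert R S hR ih =>
    rw [Finset.card_insert_of_notMem hR, genericOrderings_succ, numOrderings_insert S R hR]
    refine Nat.add_le_add ih ((Finset.sum_le_card_nsmul _ _ _ fun i hi =>
      newCells_le S R i fun h => hR (h ▸ hi)).trans ?_)
    rw [smul_eq_mul]

/-! ### Generic points on a line of given direction -/

/-- The cross product of two plane vectors, which vanishes when they are parallel. -/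
def cross (x y : Plane) : ℝ := x 0 * y 1 - x 1 * y 0

theorem cross_eq_zero_of_cross_eq_zero {x y d : Plane} (hd : d ≠ 0) (hx : cross x d = 0)
    (hy : cross y d = 0) : cross x y = 0 := by
  unfold cross at *
  have h0 : (x 0 * y 1 - x 1 * y 0) * d 0 = 0 := by linear_combination y 0 * hx - x 0 * hy
  have h1 : (x 0 * y 1 - x 1 * y 0) * d 1 = 0 := by linear_combination y 1 * hx - x 1 * hy
  by_contra h
  exact hd (Plane.ext ((mul_eq_zero.1 h0).resolve_left h) ((mul_eq_zero.1 h1).resolve_left h))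

theorem cross_swap (x y : Plane) : cross x y = -cross y x := by unfold cross; ring

theorem Plane.sq_pos {x : Plane} (h : x ≠ 0) : 0 < x 0 ^ 2 + x 1 ^ 2 := by
  simpa using Plane.sq_sub_pos h

/-- Any two different bisectors of `S` have at most one common point. -/
def DistinctBisectors (S : Finset Plane) : Prop :=
  ∀ s ∈ S.powersetCard 2, ∀ s' ∈ S.powersetCard 2, s ≠ s' →
    (equidistant s ∩ equidistant s').Subsingleton

/-- All differences of points of `s` are parallel to `u`. -/
def IsParallelTo (u : Plane) (s : Finset Plane) : Prop :=
  ∀ a ∈ s, ∀ b ∈ s, cross (a - b) u = 0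

theorem isParallelTo_pair [DecidableEq Plane] {u a b : Plane} :
    IsParallelTo u {a, b} ↔ cross (a - b) u = 0 := by
  constructor
  · intro h
    exact h a (by simp) b (by simp)
  · intro h c hc d hd
    simp only [Finset.mem_insert, Finset.mem_singleton] at hc hd
    rcases hc with rfl | rfl <;> rcases hd with rfl | rfl
    · simp [cross]
    · exact h
    · simp only [cross, PiLp.sub_apply] at h ⊢
      linear_combination -h
    · simp [cross]

/-- The midpoint of two points, by coordinates. -/
noncomputable def planeMidpoint (x y : Plane) : Plane := !₂[(x 0 + y 0) / 2, (x 1 + y 1) / 2]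

theorem bisectorForm_planeMidpoint (x y : Plane) : bisectorForm x y (planeMidpoint x y) = 0 := by
  rw [bisectorForm_apply]
  simp [planeMidpoint]
  ring

/-- `R` lies on the line through `p` with direction `u` and is in general position with respect to
`S` otherwise. -/
structure IsGenericOnLine (S : Finset Plane) (p u R : Plane) : Prop where
  dir_ne_zero : u ≠ 0
  notMem : R ∉ S
  on_line : cross (R - p) u = 0
  parallel : ∀ i ∈ S, ∀ a ∈ S, ∀ b ∈ S, a ≠ b → cross (R - i) (a - b) = 0 →
    cross (i - p) u = 0 ∧ cross (a - b) u = 0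
  vertex : ∀ i ∈ S, ∀ s ∈ S.powersetCard 2, ∀ s' ∈ S.powersetCard 2, s ≠ s' →
    ∀ v ∈ equidistant s ∩ equidistant s', bisectorForm R i v ≠ 0
  midpoint : ∀ i ∈ S, ∀ a ∈ S, ∀ b ∈ S, a ≠ b → cross (a - b) u = 0 →
    bisectorForm a b (planeMidpoint R i) ≠ 0

theorem eventually_quadratic_ne_zero (A B C : ℝ) (h : A ≠ 0 ∨ B ≠ 0 ∨ C ≠ 0) :
    ∀ᶠ t in Filter.cofinite, A * t ^ 2 + B * t + C ≠ 0 := by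
  open Polynomial in
  set P : ℝ[X] := Polynomial.C A * X ^ 2 + Polynomial.C B * X + Polynomial.C C with hP
  have hne : P ≠ 0 := by
    intro h0
    have h2 := congrArg (fun q => q.coeff 2) h0
    have h1 := congrArg (fun q => q.coeff 1) h0
    have h00 := congrArg (fun q => q.coeff 0) h0
    simp [hP, coeff_X, coeff_C] at h2 h1 h00
    tauto
  refine (P.roots.toFinset.finite_toSet).subset fun t ht => ?_
  simp only [Set.mem_compl_iff, Set.mem_ofPred_eq, not_not] at ht
  refine Finset.mem_coe.2 (Multiset.mem_toFinset.2 ((mem_roots hne).2 ?_))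
  simp [hP, ht]

/-- Along `p + t • u` each condition says that a polynomial in `t` of degree at most 2 is nonzero,
so once these polynomials are not identically zero only finitely many `t` are excluded. -/
theorem exists_isGenericOnLine (S : Finset Plane) (hD : DistinctBisectors S) (p u : Plane)
    (hu : u ≠ 0) : ∃ R, IsGenericOnLine S p u R := by
  have hu2 := Plane.sq_pos hu
  set r : ℝ → Plane := fun t => p + t • u with hr
  have r0 (t : ℝ) : r t 0 = p 0 + t * u 0 := by simp [hr]
  have r1 (t : ℝ) : r t 1 = p 1 + t * u 1 := by simp [hr]
  have quad {φ : ℝ → ℝ} (A B C : ℝ) (h : A ≠ 0 ∨ B ≠ 0 ∨ C ≠ 0)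
      (hφ : ∀ t, φ t = A * t ^ 2 + B * t + C) : ∀ᶠ t in Filter.cofinite, φ t ≠ 0 := by
    filter_upwards [eventually_quadratic_ne_zero A B C h] with t ht
    rwa [hφ]
  have e1 : ∀ᶠ t in Filter.cofinite, ∀ i ∈ S, r t ≠ i := by
    rw [Filter.eventually_all_finset]
    intro i _
    have := quad (φ := fun t => (r t 0 - i 0) ^ 2 + (r t 1 - i 1) ^ 2) (u 0 ^ 2 + u 1 ^ 2)
      (2 * (p 0 - i 0) * u 0 + 2 * (p 1 - i 1) * u 1) ((p 0 - i 0) ^ 2 + (p 1 - i 1) ^ 2)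
      (Or.inl hu2.ne') (fun t => by rw [r0, r1]; ring)
    filter_upwards [this] with t ht h
    exact ht (by rw [h]; ring)
  have e2 : ∀ᶠ t in Filter.cofinite, ∀ i ∈ S, ∀ a ∈ S, ∀ b ∈ S, a ≠ b →
      cross (r t - i) (a - b) = 0 → cross (i - p) u = 0 ∧ cross (a - b) u = 0 := by
    simp only [Filter.eventually_all_finset]
    intro i _ a _ b _
    by_cases hc : a ≠ b ∧ ¬(cross (i - p) u = 0 ∧ cross (a - b) u = 0)
    · have hd : a - b ≠ 0 := sub_ne_zero.2 hc.1
      have := quad (φ := fun t => cross (r t - i) (a - b)) 0 (cross u (a - b))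
        (cross (p - i) (a - b)) (by
          -- If both coefficients vanish, `u` and `p - i` are parallel to `a - b`, the very case
          -- that is permitted.
          by_contra! h
          refine hc.2 ⟨?_, by rw [cross_swap, h.2.1, neg_zero]⟩
          have := cross_eq_zero_of_cross_eq_zero hd h.2.2 h.2.1
          simp only [cross, PiLp.sub_apply] at this ⊢
          linear_combination -this) (fun t => by
          simp only [cross, PiLp.sub_apply, r0, r1]; ring)
      filter_upwards [this] with t ht _ h
      exact absurd h ht
    · refine Filter.Eventually.of_forall fun t hab _ => ?_
      by_contra h
      exact hc ⟨hab, h⟩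
  -- Distinct bisectors share at most one point, so there are finitely many old vertices to avoid.
  have hfin : {v | ∃ s ∈ S.powersetCard 2, ∃ s' ∈ S.powersetCard 2, s ≠ s' ∧
      v ∈ equidistant s ∩ equidistant s'}.Finite := by
    have : {v | ∃ s ∈ S.powersetCard 2, ∃ s' ∈ S.powersetCard 2, s ≠ s' ∧
        v ∈ equidistant s ∩ equidistant s'} =
        ⋃ s ∈ S.powersetCard 2, ⋃ s' ∈ S.powersetCard 2,
          {v | s ≠ s' ∧ v ∈ equidistant s ∩ equidistant s'} := by
      ext; simp only [Set.mem_ofPred_eq, Set.mem_iUnion, exists_prop]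
    rw [this]
    refine (Finset.finite_toSet _).biUnion fun s hs => (Finset.finite_toSet _).biUnion
      fun s' hs' => Set.Subsingleton.finite fun x hx y hy => hD s hs s' hs' hx.1 hx.2 hy.2
  have e3 : ∀ᶠ t in Filter.cofinite, ∀ i ∈ S, ∀ v ∈ {v | ∃ s ∈ S.powersetCard 2,
      ∃ s' ∈ S.powersetCard 2, s ≠ s' ∧ v ∈ equidistant s ∩ equidistant s'},
      bisectorForm (r t) i v ≠ 0 := by
    rw [Filter.eventually_all_finset]
    intro i _
    rw [Filter.eventually_all_finite hfin]
    intro v _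
    refine quad (-(u 0 ^ 2 + u 1 ^ 2) / 2) (u 0 * v 0 + u 1 * v 1 - p 0 * u 0 - p 1 * u 1)
      ((p 0 - i 0) * v 0 + (p 1 - i 1) * v 1 +
        (i 0 ^ 2 + i 1 ^ 2 - p 0 ^ 2 - p 1 ^ 2) / 2) (Or.inl (by linarith)) fun t => ?_
    rw [bisectorForm_apply, r0, r1]
    ring
  have e4 : ∀ᶠ t in Filter.cofinite, ∀ i ∈ S, ∀ a ∈ S, ∀ b ∈ S, a ≠ b → cross (a - b) u = 0 →
      bisectorForm a b (planeMidpoint (r t) i) ≠ 0 := by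
    simp only [Filter.eventually_all_finset]
    intro i _ a _ b _
    by_cases hc : a ≠ b ∧ cross (a - b) u = 0
    · have hd := Plane.sq_sub_pos hc.1
      have hc2 := hc.2
      simp only [cross, PiLp.sub_apply] at hc2
      have := quad (φ := fun t => bisectorForm a b (planeMidpoint (r t) i)) 0
        (((a 0 - b 0) * u 0 + (a 1 - b 1) * u 1) / 2)
        ((a 0 - b 0) * ((p 0 + i 0) / 2) + (a 1 - b 1) * ((p 1 + i 1) / 2) +
          (b 0 ^ 2 + b 1 ^ 2 - a 0 ^ 2 - a 1 ^ 2) / 2) (by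
          -- The linear coefficient is half the inner product of `a - b` and `u`, nonzero because
          -- these are nonzero parallel vectors (Lagrange's identity).
          refine Or.inr (Or.inl fun h => ?_)
          have hpos := mul_pos hd hu2
          have : ((a 0 - b 0) ^ 2 + (a 1 - b 1) ^ 2) * (u 0 ^ 2 + u 1 ^ 2) = 0 := by
            linear_combination ((a 0 - b 0) * u 1 - (a 1 - b 1) * u 0) * hc2 +
              2 * ((a 0 - b 0) * u 0 + (a 1 - b 1) * u 1) * h
          linarith) (fun t => by
          rw [bisectorForm_apply]
          simp only [planeMidpoint, r0, r1]
          simp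
          ring)
      filter_upwards [this] with t ht _ _
      exact ht
    · exact Filter.Eventually.of_forall fun t h1 h2 => absurd ⟨h1, h2⟩ hc
  obtain ⟨t, h1, h2, h3, h4⟩ := (e1.and (e2.and (e3.and e4))).exists
  exact ⟨r t, hu, fun h => h1 _ h rfl, by simp only [cross, PiLp.sub_apply, r0, r1]; ring, h2,
    fun i hi s hs s' hs' hne v hv => h3 i hi v ⟨s, hs, s', hs', hne, hv⟩, h4⟩

namespace IsGenericOnLine

variable {S : Finset Plane} {p u R : Plane}

theorem ne_of_mem (h : IsGenericOnLine S p u R) {i : Plane} (hi : i ∈ S) : R ≠ i :=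
  fun h' => h.notMem (h' ▸ hi)

/-- Otherwise `R - i` and `a - b` are parallel, and parallel bisectors with a common point coincide.
The midpoint of `R, i` would then lie on the bisector of `a, b`, which `midpoint` forbids. -/
theorem not_parallel_of_common_point (h : IsGenericOnLine S p u R) {i a b x : Plane} (hi : i ∈ S)
    (ha : a ∈ S) (hb : b ∈ S) (hab : a ≠ b) (hx : bisectorForm R i x = 0)
    (hx' : bisectorForm a b x = 0) : ¬(cross (i - p) u = 0 ∧ cross (a - b) u = 0) := by
  rintro ⟨h1, h2⟩
  refine h.midpoint i hi a ha b hb hab h2 ?_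
  have hRi := h.ne_of_mem hi
  have h3 : cross (R - i) u = 0 := by
    have := h.on_line
    simp only [cross, PiLp.sub_apply] at *
    linear_combination this - h1
  have hd := Plane.sq_sub_pos hRi
  have h4 : cross (a - b) (R - i) = 0 :=
    cross_eq_zero_of_cross_eq_zero h.dir_ne_zero h2 h3
  rw [bisectorForm_apply] at hx hx' ⊢
  simp only [cross, PiLp.sub_apply] at h4
  have key : ((a 0 - b 0) * (x 0 - (R 0 + i 0) / 2) + (a 1 - b 1) * (x 1 - (R 1 + i 1) / 2)) *
      ((R 0 - i 0) ^ 2 + (R 1 - i 1) ^ 2) = 0 := by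
    linear_combination ((a 0 - b 0) * (R 0 - i 0) + (a 1 - b 1) * (R 1 - i 1)) * hx +
      ((x 0 - (R 0 + i 0) / 2) * (R 1 - i 1) - (x 1 - (R 1 + i 1) / 2) * (R 0 - i 0)) * h4
  have := (mul_eq_zero.1 key).resolve_right hd.ne'
  simp [planeMidpoint]
  linear_combination hx' - this

theorem not_contained (h : IsGenericOnLine S p u R) {i a b : Plane} (hi : i ∈ S)
    (ha : a ∈ S) (hb : b ∈ S) (hab : a ≠ b) :
    ¬∀ x, bisectorForm R i x = 0 → bisectorForm a b x = 0 := by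
  intro hc
  have h1 := hc _ (bisectorForm_planeMidpoint R i)
  -- A second point of the bisector of `R, i`; comparing it with the midpoint shows `R - i` parallel
  -- to `a - b`.
  have h2 := hc !₂[(R 0 + i 0) / 2 - (R 1 - i 1), (R 1 + i 1) / 2 + (R 0 - i 0)] (by
    rw [bisectorForm_apply]; simp; ring)
  refine h.not_parallel_of_common_point hi ha hb hab (bisectorForm_planeMidpoint R i) h1
    (h.parallel i hi a ha b hb hab ?_)
  rw [bisectorForm_apply] at h1 h2
  simp [planeMidpoint] at h1 h2
  simp only [cross, PiLp.sub_apply]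
  linear_combination h2 - h1

theorem exists_common_point (h : IsGenericOnLine S p u R) {i a b : Plane} (hi : i ∈ S)
    (ha : a ∈ S) (hb : b ∈ S) (hab : a ≠ b) (hnp : ¬(cross (i - p) u = 0 ∧ cross (a - b) u = 0)) :
    ∃ x, bisectorForm R i x = 0 ∧ bisectorForm a b x = 0 := by
  have hdet : cross (R - i) (a - b) ≠ 0 := fun h0 => hnp (h.parallel i hi a ha b hb hab h0)
  simp only [cross, PiLp.sub_apply] at hdet
  set c := (i 0 ^ 2 + i 1 ^ 2 - R 0 ^ 2 - R 1 ^ 2) / 2 with hc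
  set d := (b 0 ^ 2 + b 1 ^ 2 - a 0 ^ 2 - a 1 ^ 2) / 2 with hd
  obtain ⟨D, hD⟩ : ∃ D, D = (R 0 - i 0) * (a 1 - b 1) - (R 1 - i 1) * (a 0 - b 0) := ⟨_, rfl⟩
  rw [← hD] at hdet
  -- Cramer's rule for the two line equations.
  refine ⟨!₂[(d * (R 1 - i 1) - c * (a 1 - b 1)) / D,
    (c * (a 0 - b 0) - d * (R 0 - i 0)) / D], ?_, ?_⟩
  · rw [bisectorForm_apply, ← hc]
    simp
    field_simp
    linear_combination c * hD
  · rw [bisectorForm_apply, ← hd]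
    simp
    field_simp
    linear_combination d * hD

-- Each pair not forced to be parallel gives one intersection point, and `vertex` keeps the points
-- of different pairs apart. The lost pairs are added on the left to avoid truncated subtraction.
open Classical in
theorem newCells_add (h : IsGenericOnLine S p u R) {i : Plane} (hi : i ∈ S) :
    newCells S R i + (if cross (i - p) u = 0 then
      ((S.powersetCard 2).filter (IsParallelTo u)).card else 0) = 1 + S.card.choose 2 := by
  set F := (S.powersetCard 2).filter (fun s => ¬(cross (i - p) u = 0 ∧ IsParallelTo u s)) with hF
  have hpt : ∀ s ∈ F, ∃ x, bisectorForm R i x = 0 ∧ x ∈ equidistant s := by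
    intro s hs
    obtain ⟨hs, hnp⟩ := Finset.mem_filter.1 hs
    obtain ⟨hsS, hs2⟩ := Finset.mem_powersetCard.1 hs
    obtain ⟨a, b, hab, rfl⟩ := Finset.card_eq_two.1 hs2
    rw [isParallelTo_pair] at hnp
    obtain ⟨x, hx, hx'⟩ := h.exists_common_point hi (hsS (by simp)) (hsS (by simp)) hab hnp
    exact ⟨x, hx, mem_equidistant_pair.2 hx'⟩
  choose! f hf hfe using hpt
  have hset : {x | bisectorForm R i x = 0 ∧ ∃ s ∈ S.powersetCard 2, x ∈ equidistant s} =
      f '' F := by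
    ext x
    constructor
    · rintro ⟨hx, s, hs, hxs⟩
      have hsF : s ∈ F := by
        refine Finset.mem_filter.2 ⟨hs, ?_⟩
        obtain ⟨hsS, hs2⟩ := Finset.mem_powersetCard.1 hs
        obtain ⟨a, b, hab, rfl⟩ := Finset.card_eq_two.1 hs2
        rw [isParallelTo_pair]
        exact h.not_parallel_of_common_point hi (hsS (by simp)) (hsS (by simp)) hab hx
          (mem_equidistant_pair.1 hxs)
      refine ⟨s, hsF, ?_⟩
      by_contra hne
      -- the bisector of `s` would contain the line of `R` and `i`
      obtain ⟨hsS, hs2⟩ := Finset.mem_powersetCard.1 hs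
      have hfs := hfe s hsF
      obtain ⟨a, b, hab, rfl⟩ := Finset.card_eq_two.1 hs2
      exact h.not_contained hi (hsS (by simp)) (hsS (by simp)) hab
        (bisectorForm_eq_zero_of_two_zeros (h.ne_of_mem hi) hne (hf _ hsF) hx
          (mem_equidistant_pair.1 hfs) (mem_equidistant_pair.1 hxs))
    · rintro ⟨s, hs, rfl⟩
      exact ⟨hf s hs, s, (Finset.mem_filter.1 hs).1, hfe s hs⟩
  have hinj : Set.InjOn f F := by
    intro s hs s' hs' hss
    by_contra hne
    exact h.vertex i hi s (Finset.mem_filter.1 hs).1 s' (Finset.mem_filter.1 hs').1 hne (f s)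
      ⟨hfe s hs, hss ▸ hfe s' hs'⟩ (hf s hs)
  have hnc : ¬∃ a ∈ S, ∃ b ∈ S, a ≠ b ∧ ∀ x, bisectorForm R i x = 0 → bisectorForm a b x = 0 := by
    rintro ⟨a, ha, b, hb, hab, hc⟩
    exact h.not_contained hi ha hb hab hc
  rw [newCells, if_neg hnc, hset, hinj.ncard_image, Set.ncard_coe_finset, add_assoc,
    ← Finset.card_powersetCard]
  congr 1
  split_ifs with hL
  · rw [hF, add_comm, ← Finset.card_filter_add_card_filter_not (s := S.powersetCard 2)
      (IsParallelTo u)]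
    simp [hL]
  · simp [hF, hL]

open Classical in
theorem numOrderings_insert_add (h : IsGenericOnLine S p u R) :
    numOrderings (insert R S) + (S.filter (fun i => cross (i - p) u = 0)).card *
      ((S.powersetCard 2).filter (IsParallelTo u)).card =
      numOrderings S + S.card * (1 + S.card.choose 2) := by
  rw [numOrderings_insert S R h.notMem, add_assoc, ← smul_eq_mul (S.card), ← Finset.sum_const,
    ← Finset.sum_congr rfl fun i hi => h.newCells_add hi, Finset.sum_add_distrib,
    ← Finset.sum_filter, Finset.sum_const, smul_eq_mul]

open Classical in
theorem distinctBisectors_insert (h : IsGenericOnLine S p u R) (hD : DistinctBisectors S) :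
    DistinctBisectors (insert R S) := by
  have key : ∀ i ∈ S, ∀ a ∈ S, ∀ b ∈ S, a ≠ b →
      ({x | bisectorForm R i x = 0} ∩ {x | bisectorForm a b x = 0}).Subsingleton := by
    intro i hi a ha b hb hab x hx y hy
    by_contra hxy
    exact h.not_contained hi ha hb hab
      (bisectorForm_eq_zero_of_two_zeros (h.ne_of_mem hi) hxy hx.1 hy.1 hx.2 hy.2)
  have hcases : ∀ s ∈ (insert R S).powersetCard 2,
      s ∈ S.powersetCard 2 ∨ ∃ i ∈ S, s = {R, i} := by
    intro s hs
    rw [Finset.powersetCard_succ_insert h.notMem, Finset.mem_union] at hs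
    refine hs.imp id fun hs => ?_
    obtain ⟨t, ht, rfl⟩ := Finset.mem_image.1 hs
    obtain ⟨htS, ht1⟩ := Finset.mem_powersetCard.1 ht
    obtain ⟨i, rfl⟩ := Finset.card_eq_one.1 ht1
    exact ⟨i, htS (by simp), rfl⟩
  have key2 : ∀ i ∈ S, ∀ s ∈ S.powersetCard 2,
      (equidistant {R, i} ∩ equidistant s).Subsingleton := by
    intro i hi s hs x hx y hy
    obtain ⟨hsS, hs2⟩ := Finset.mem_powersetCard.1 hs
    obtain ⟨a, b, hab, rfl⟩ := Finset.card_eq_two.1 hs2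
    simp only [Set.mem_inter_iff, mem_equidistant_pair] at hx hy
    exact key i hi a (hsS (by simp)) b (hsS (by simp)) hab hx hy
  intro s hs s' hs' hne
  rcases hcases s hs with hs | ⟨i, hi, rfl⟩ <;> rcases hcases s' hs' with hs' | ⟨j, hj, rfl⟩
  · exact hD s hs s' hs' hne
  · rw [Set.inter_comm]
    exact key2 j hj s hs
  · exact key2 i hi s' hs'
  -- Points common to the bisectors of `R, i` and `R, j` lie on that of `i, j`, which reduces to a
  -- new and an old bisector.
  · have hij : i ≠ j := fun h => hne (h ▸ rfl)
    intro x hx y hy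
    simp only [Set.mem_inter_iff, mem_equidistant_pair] at hx hy
    refine key i hi i hi j hj hij ⟨hx.1, ?_⟩ ⟨hy.1, ?_⟩
    · have := bisectorForm_cocycle R i j x
      change bisectorForm i j x = 0
      linarith
    · have := bisectorForm_cocycle R i j y
      change bisectorForm i j y = 0
      linarith

end IsGenericOnLine

/-! ### Building sets with prescribed deficiency -/

/-- The only pair of points of `S` whose difference is parallel to `a - b` is `a`, `b`. -/
def UniqueDirection (S : Finset Plane) (a b : Plane) : Prop :=
  ∀ c ∈ S, ∀ d ∈ S, c ≠ d → cross (c - d) (a - b) = 0 → c = a ∧ d = b ∨ c = b ∧ d = a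

-- A pair parallel to `R - i` that contains `R` and some `d ≠ i` would make `R, i, d` collinear, so
-- `R - i` would be parallel to the old difference `d - i`. Thus only old pairs matter, and `hno`
-- excludes them.
open Classical in
theorem IsGenericOnLine.uniqueDirection_insert {S : Finset Plane} {p u R i : Plane}
    (h : IsGenericOnLine S p u R) (hi : i ∈ S)
    (hno : cross (i - p) u ≠ 0 ∨ ∀ a ∈ S, ∀ b ∈ S, a ≠ b → cross (a - b) u ≠ 0) :
    UniqueDirection (insert R S) i R := by
  have hne : ∀ a ∈ S, ∀ b ∈ S, a ≠ b → cross (R - i) (a - b) ≠ 0 := by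
    intro a ha b hb hab h0
    obtain ⟨h1, h2⟩ := h.parallel i hi a ha b hb hab h0
    exact hno.elim (fun h' => h' h1) fun h' => h' a ha b hb hab h2
  intro c hc d hd hcd hcross
  rcases Finset.mem_insert.1 hc with hcR | hcS <;> rcases Finset.mem_insert.1 hd with hdR | hdS
  · exact absurd (hcR.trans hdR.symm) hcd
  · refine Or.inr ⟨hcR, ?_⟩
    by_contra hdi
    refine hne d hdS i hi hdi ?_
    rw [hcR] at hcross
    simp only [cross, PiLp.sub_apply] at hcross ⊢
    linear_combination -hcross
  · refine Or.inl ⟨?_, hdR⟩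
    by_contra hci
    refine hne c hcS i hi hci ?_
    rw [hdR] at hcross
    simp only [cross, PiLp.sub_apply] at hcross ⊢
    linear_combination hcross
  · refine absurd ?_ (hne c hcS d hdS hcd)
    simp only [cross, PiLp.sub_apply] at hcross ⊢
    linear_combination hcross

theorem exists_direction_not_parallel (S : Finset Plane) :
    ∃ u : Plane, u ≠ 0 ∧ ∀ a ∈ S, ∀ b ∈ S, a ≠ b → cross (a - b) u ≠ 0 := by
  have : ∀ᶠ t : ℝ in Filter.cofinite, ∀ a ∈ S, ∀ b ∈ S, a ≠ b →
      cross (a - b) !₂[1, t] ≠ 0 := by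
    simp only [Filter.eventually_all_finset]
    intro a _ b _
    by_cases hab : a = b
    · exact Filter.Eventually.of_forall fun _ h => absurd hab h
    · filter_upwards [eventually_quadratic_ne_zero 0 (a 0 - b 0) (-(a 1 - b 1)) (by
        by_contra! h
        exact hab (Plane.ext (by linarith [h.2.1]) (by linarith [h.2.2])))] with t ht _ h0
      refine ht ?_
      simp [cross] at h0
      linear_combination h0
  obtain ⟨t, ht⟩ := this.exists
  refine ⟨!₂[1, t], fun h => ?_, ht⟩
  have := congrArg (fun z : Plane => z 0) h
  simp at this

/-- Some `n` points with distinct bisectors have `k` orderings fewer than the generic number. -/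
def HasDeficiency (n k : ℕ) : Prop :=
  ∃ S : Finset Plane, S.card = n ∧ DistinctBisectors S ∧ numOrderings S + k = genericOrderings n

/-- As `HasDeficiency`, where moreover some pair of points has a direction of its own. -/
def HasDeficiencyUnique (n k : ℕ) : Prop :=
  ∃ S : Finset Plane, S.card = n ∧ DistinctBisectors S ∧
    numOrderings S + k = genericOrderings n ∧ ∃ a ∈ S, ∃ b ∈ S, a ≠ b ∧ UniqueDirection S a b

theorem HasDeficiencyUnique.hasDeficiency {n k : ℕ} (h : HasDeficiencyUnique n k) :
    HasDeficiency n k := by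
  obtain ⟨S, h1, h2, h3, -⟩ := h
  exact ⟨S, h1, h2, h3⟩

theorem HasDeficiency.succ {n k : ℕ} (h : HasDeficiency n k) (hn : 1 ≤ n) :
    HasDeficiencyUnique (n + 1) k := by
  classical
  obtain ⟨S, rfl, hD, hnum⟩ := h
  obtain ⟨i, hi⟩ := Finset.card_pos.1 hn
  obtain ⟨u, hu, hpar⟩ := exists_direction_not_parallel S
  obtain ⟨R, hR⟩ := exists_isGenericOnLine S hD i u hu
  refine ⟨insert R S, Finset.card_insert_of_notMem hR.notMem, hR.distinctBisectors_insert hD, ?_,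
    i, Finset.mem_insert_of_mem hi, R, Finset.mem_insert_self _ _, (hR.ne_of_mem hi).symm,
    hR.uniqueDirection_insert hi (Or.inr hpar)⟩
  have h0 : (S.powersetCard 2).filter (IsParallelTo u) = ∅ := by
    refine Finset.filter_eq_empty_iff.2 fun s hs h => ?_
    obtain ⟨hsS, hs2⟩ := Finset.mem_powersetCard.1 hs
    obtain ⟨a, b, hab, rfl⟩ := Finset.card_eq_two.1 hs2
    exact hpar a (hsS (by simp)) b (hsS (by simp)) hab (isParallelTo_pair.1 h)
  have := hR.numOrderings_insert_add
  rw [h0, Finset.card_empty, mul_zero, add_zero] at this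
  rw [genericOrderings_succ]
  omega

/-- The line through a third point `i`, parallel to `a - b`, contains no other point of `S`, and
only one pair has its direction, so the loss is `1 * 1`. The pair `a, R` then has a direction of its
own, since `a` is off that line. -/
theorem HasDeficiencyUnique.succ_succ {n k : ℕ} (h : HasDeficiencyUnique n k) (hn : 3 ≤ n) :
    HasDeficiencyUnique (n + 1) (k + 1) := by
  classical
  obtain ⟨S, rfl, hD, hnum, a, ha, b, hb, hab, huniq⟩ := h
  obtain ⟨i, hi, hiab⟩ : ∃ i ∈ S, i ∉ ({a, b} : Finset Plane) :=
    Finset.exists_mem_notMem_of_card_lt_card (Finset.card_le_two.trans_lt hn)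
  simp only [Finset.mem_insert, Finset.mem_singleton, not_or] at hiab
  have hline : ∀ j ∈ S, cross (j - i) (a - b) = 0 → j = i := by
    intro j hj h0
    by_contra hne
    rcases huniq j hj i hi hne h0 with h | h
    · exact hiab.2 h.2
    · exact hiab.1 h.2
  obtain ⟨R, hR⟩ := exists_isGenericOnLine S hD i (a - b) (sub_ne_zero.2 hab)
  refine ⟨insert R S, Finset.card_insert_of_notMem hR.notMem, hR.distinctBisectors_insert hD, ?_,
    a, Finset.mem_insert_of_mem ha, R, Finset.mem_insert_self _ _, (hR.ne_of_mem ha).symm,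
    hR.uniqueDirection_insert ha (Or.inl fun h => hiab.1 (hline a ha h).symm)⟩
  have h1 : S.filter (fun j => cross (j - i) (a - b) = 0) = {i} := by
    ext j
    simp only [Finset.mem_filter, Finset.mem_singleton]
    refine ⟨fun h => hline j h.1 h.2, ?_⟩
    rintro rfl
    exact ⟨hi, by simp [cross]⟩
  have h2 : (S.powersetCard 2).filter (IsParallelTo (a - b)) = {{a, b}} := by
    ext s
    simp only [Finset.mem_filter, Finset.mem_singleton]
    constructor
    · rintro ⟨hs, hpar⟩
      obtain ⟨hsS, hs2⟩ := Finset.mem_powersetCard.1 hs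
      obtain ⟨c, d, hcd, rfl⟩ := Finset.card_eq_two.1 hs2
      rcases huniq c (hsS (by simp)) d (hsS (by simp)) hcd (isParallelTo_pair.1 hpar) with
        ⟨rfl, rfl⟩ | ⟨rfl, rfl⟩
      · rfl
      · exact Finset.pair_comm _ _
    · rintro rfl
      refine ⟨Finset.mem_powersetCard.2 ⟨?_, Finset.card_pair hab⟩,
        isParallelTo_pair.2 (by unfold cross; ring)⟩
      intro x hx
      simp only [Finset.mem_insert, Finset.mem_singleton] at hx
      rcases hx with rfl | rfl <;> assumption
  have := hR.numOrderings_insert_add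
  rw [h1, h2, Finset.card_singleton, Finset.card_singleton] at this
  rw [genericOrderings_succ]
  omega

theorem hasDeficiency_one_zero : HasDeficiency 1 0 := by
  classical
  refine ⟨{0}, Finset.card_singleton _, ?_, ?_⟩
  · intro s hs
    rw [Finset.powersetCard_eq_empty.2 (by simp)] at hs
    simp at hs
  · have := numOrderings_insert ∅ (0 : Plane) (by simp)
    rw [numOrderings_empty, Finset.sum_empty] at this
    simpa [genericOrderings] using this

/-- Three points on a line lose two orderings. -/
theorem hasDeficiency_three_two : HasDeficiency 3 2 := by
  classical
  obtain ⟨S, hS, hD, hnum⟩ := (hasDeficiency_one_zero.succ le_rfl).hasDeficiency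
  obtain ⟨a, b, hab, rfl⟩ := Finset.card_eq_two.1 hS
  replace hS : ({a, b} : Finset Plane).card = 2 := hS
  replace hnum : numOrderings ({a, b} : Finset Plane) + 0 = genericOrderings 2 := hnum
  -- The line through `a` and `b` contains two old points and one pair has its direction: the loss
  -- is `2 * 1`.
  obtain ⟨R, hR⟩ := exists_isGenericOnLine _ hD a (a - b) (sub_ne_zero.2 hab)
  refine ⟨_, by rw [Finset.card_insert_of_notMem hR.notMem, hS],
    hR.distinctBisectors_insert hD, ?_⟩
  have h1 : ({a, b} : Finset Plane).filter (fun j => cross (j - a) (a - b) = 0) = {a, b} := by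
    refine Finset.filter_true_of_mem fun j hj => ?_
    simp only [Finset.mem_insert, Finset.mem_singleton] at hj
    rcases hj with rfl | rfl <;> simp only [cross, PiLp.sub_apply] <;> ring
  have h2 : (({a, b} : Finset Plane).powersetCard 2).filter (IsParallelTo (a - b)) = {{a, b}} := by
    have hpc : ({a, b} : Finset Plane).powersetCard 2 = {{a, b}} := by
      have := Finset.powersetCard_self ({a, b} : Finset Plane)
      rwa [hS] at this
    rw [hpc]
    refine Finset.filter_true_of_mem fun s hs => ?_
    rw [Finset.mem_singleton.1 hs]
    exact isParallelTo_pair.2 (by unfold cross; ring)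
  have := hR.numOrderings_insert_add
  rw [h1, h2, hS, Finset.card_singleton] at this
  rw [genericOrderings_succ]
  omega

theorem hasDeficiencyUnique_of_add_three_le {n k : ℕ} (h : k + 3 ≤ n) :
    HasDeficiencyUnique n k := by
  obtain ⟨m, rfl⟩ := Nat.exists_eq_add_of_le h
  clear h
  induction k generalizing m with
  | zero =>
    induction m with
    | zero => exact (hasDeficiency_one_zero.succ le_rfl).hasDeficiency.succ (by norm_num)
    | succ m ih => exact ih.hasDeficiency.succ (by omega)
  | succ k ih =>
    have := (ih m).succ_succ (by omega)
    rwa [show k + 1 + 3 + m = k + 3 + m + 1 by ring]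

theorem hasDeficiency_of_two_mul_le {n k : ℕ} (hn : 4 ≤ n) (hk : 2 * k ≤ n) :
    HasDeficiency n k := by
  by_cases h : k + 3 ≤ n
  · exact (hasDeficiencyUnique_of_add_three_le h).hasDeficiency
  -- The only case beyond `k + 3 ≤ n`: three collinear points and a generic fourth.
  · obtain ⟨rfl, rfl⟩ : n = 4 ∧ k = 2 := by omega
    exact (hasDeficiency_three_two.succ (by norm_num)).hasDeficiency

theorem maxOrderings_two {n : ℕ} (hn : 4 ≤ n) : maxOrderings n 2 = genericOrderings n := by
  obtain ⟨⟨S, hS, hmax⟩, hub⟩ := maxOrderings_isGreatest n 2 (by norm_num)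
  refine le_antisymm ?_ ?_
  · rw [← hmax, ← hS]
    exact numOrderings_le S
  · obtain ⟨T, hT, -, hnum⟩ := hasDeficiency_of_two_mul_le (k := 0) hn (by omega)
    exact hub ⟨T, hT, hnum⟩

theorem theoremT (n k : ℕ) (hk : (k : ℝ) ≤ (n : ℝ) / 2) (hn : 4 ≤ n ∨ k = 0) :
    ∃ S : Finset (EuclideanSpace ℝ (Fin 2)),
      S.card = n ∧ (numOrderings S : ℤ) = (maxOrderings n 2 : ℤ) - (k : ℤ) := by
  -- For `k = 0` the attained maximum serves for every `n`, including `n < 4`, where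
  -- `maxOrderings_two` does not apply.
  rcases Nat.eq_zero_or_pos k with rfl | hkpos
  · obtain ⟨⟨S, hS, hmax⟩, -⟩ := maxOrderings_isGreatest n 2 (by norm_num)
    exact ⟨S, hS, by simp [hmax]⟩
  · have hn4 : 4 ≤ n := hn.resolve_right hkpos.ne'
    have hk' : 2 * k ≤ n := by
      have : (2 * k : ℝ) ≤ n := by linarith
      exact_mod_cast this
    obtain ⟨S, hS, -, hnum⟩ := hasDeficiency_of_two_mul_le hn4 hk'
    refine ⟨S, hS, ?_⟩
    rw [maxOrderings_two hn4, ← hnum]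
    push_cast
    ring
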